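/- Let $n\ge 1$ and let $\pi$ be a probability measure on the product of the unit sphere of $\mathbb C^n$ and $\mathbb R$; denote by $((a_1,\dots,a_n),h)$ its generic element. Assume that under $\pi$ the vector $a=(a_1,\dots,a_n)$ is independent of $h$, that the law of $a$ is invariant under permutations of the coordinates and under multiplication of each coordinate by a complex number of modulus $1$, and that $\pi$-almost surely all $a_j$ are nonzero. Put $\rho_j=|a_j|^2$. Let $\mathbb P$ be a probability measure on the space of sets $V=\{u_1,\dots,u_n\}$ of $n$ distinct points of the unit circle $\mathbb U$ (with the $\sigma$-algebra generated by the counts $V\mapsto \#(V\cap B)$, $B\subset\mathbb U$ Borel; the points are numbered in any measurable way). For the measure $\sigma=\sum_{j=1}^n\rho_j\delta_{u_j}$ let $\Phi_0,\dots,\Phi_n$ be its monic orthogonal polynomials, i.e. $\Phi_k$ is the monic polynomial of degree $k$ orthogonal to $1,z,\dots,z^{k-1}$ in $L^2(\sigma)$, and let $\alpha_k=-\overline{\Phi_{k+1}(0)}$, $0\le k\le n-1$, be its Verblunsky coefficients. Assume that under $\mathbb P\otimes\pi$, for every $c\in\mathbb U$, the sequence $(c\,\alpha_0,\dots,c\,\alpha_{n-1})$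 has the same law as $(\alpha_0,\dots,\alpha_{n-1})$. Then, for every $V$, $\pi$-almost surely the set $W$ of the solutions $u\in\mathbb C\setminus\{u_1,\dots,u_n\}$ of $$\sum_{j=1}^n i\rho_j\,\frac{u_j+u}{u_j-u}=h$$ consists of exactly $n$ points, all on $\mathbb U$, and under $\mathbb P\otimes\pi$ the law of $W$ is $\mathbb P$. In other words, $\mathbb P$ is invariant for the Markov chain on sets of $n$ points of $\mathbb U$ whose transition sends $V$ to the law under $\pi$ of the solution set $W$. -/

import Mathlib

open MeasureTheory ProbabilityTheory Polynomial

noncomputable section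

instance Circle.instMeasurableSpaceBorel : MeasurableSpace Circle := borel Circle

instance Circle.instBorelSpaceBorel : BorelSpace Circle := ⟨rfl⟩

/-- The space of sets of `n` (distinct) points on the unit circle. -/
@[ext]
structure CirclePoints (n : ℕ) where
  carrier : Finset Circle
  card_eq : carrier.card = n

/-- The usual σ-algebra on point configurations: the one generated by the counting maps
`V ↦ #(V ∩ B)`, for `B` a Borel subset of the circle. -/
instance CirclePoints.measurableSpace (n : ℕ) : MeasurableSpace (CirclePoints n) :=
  ⨆ (B : Set Circle) (_ : MeasurableSet B),
    MeasurableSpace.comap (fun V : CirclePoints n => ((V.carrier : Set Circle) ∩ B).ncard) ⊤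

/-- The unit sphere of `ℂⁿ`, for the Hermitian norm. -/
abbrev ComplexSphere (n : ℕ) : Type :=
  Metric.sphere (0 : EuclideanSpace ℂ (Fin n)) 1

/-- The weights `ρ_j = |a_j|²`. -/
def weight {n : ℕ} (a : ComplexSphere n) (j : Fin n) : ℝ :=
  ‖(a : EuclideanSpace ℂ (Fin n)) j‖ ^ 2

/-- The measure `σ = ∑_j |a_j|² δ_{u_j}` on the unit circle. -/
def spectralMeasure {n : ℕ} (u : Fin n → Circle) (a : ComplexSphere n) : Measure Circle :=
  ∑ j, ENNReal.ofReal (weight a j) • Measure.dirac (u j)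

/-- The (sesquilinear) inner product `⟨p, q⟩ = ∫ conj (p z) * q z dσ(z)` of two polynomials
in `L²(σ)`. -/
def polyInner (σ : Measure Circle) (p q : ℂ[X]) : ℂ :=
  ∫ z : Circle, (starRingEnd ℂ) (p.eval (z : ℂ)) * q.eval (z : ℂ) ∂σ

/-- The monic orthogonal polynomials `Φ_0, Φ_1, …` of `σ`, obtained from `1, X, X², …` by the
Gram-Schmidt process (without normalization) in `L²(σ)`. If `σ` is carried by exactly `n` points
then `Φ_0, …, Φ_n` are well defined, and `Φ_n` is the monic polynomial of degree `n` vanishing at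
these points. -/
def monicOrthogonal (σ : Measure Circle) (k : ℕ) : ℂ[X] :=
  X ^ k - ∑ j : Fin k,
    C (polyInner σ (monicOrthogonal σ j) (X ^ k) /
        polyInner σ (monicOrthogonal σ j) (monicOrthogonal σ j)) *
      monicOrthogonal σ j
termination_by k
decreasing_by all_goals exact j.isLt

/-- The Verblunsky coefficients `α_k = - conj (Φ_{k+1}(0))` of `σ`. If `σ` is carried by exactly
`n` points, then these are well defined for `0 ≤ k ≤ n - 1`, with `|α_{n-1}| = 1`. -/
def verblunsky (σ : Measure Circle) (k : ℕ) : ℂ :=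
  -(starRingEnd ℂ) ((monicOrthogonal σ (k + 1)).eval 0)

/-- `z` is a solution of `∑_j i ρ_j (u_j + z) / (u_j - z) = h` (in particular, `z` is not one of
the poles `u_j`). -/
def IsInterlacingSolution {n : ℕ} (u : Fin n → Circle) (ρ : Fin n → ℝ) (h : ℝ) (z : ℂ) : Prop :=
  (∀ j, z ≠ (u j : ℂ)) ∧
    ∑ j, Complex.I * (ρ j : ℂ) * (((u j : ℂ) + z) / ((u j : ℂ) - z)) = (h : ℂ)

end

open scoped ComplexConjugate

/-! ### Discrete inner products -/

/-! Both `V` and `W` are zero sets of a degree-`n` polynomial produced by the Szegő recursion: `V`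
from the coefficients `α_k`, and `W` from `c α_k`, where `c = (ih - 1)/(ih + 1)` lies on the circle.
Since `h` is independent of `(V, a)`, conditioning on `h` makes `c` a constant. Rotation invariance
then gives the two coefficient vectors the same law, hence `W` and `V` the same law.

To identify `W`, put `F(z) = ∑ ρ_j (u_j + z)/(u_j - z)`, so that the equation reads `F(z) = -ih`.
Started from `(F + 1, F - 1)`, the recursion is solved by explicit sums over the nodes
(`szegoVec_spectralMeasure`). Its first component vanishes at step `n` because `Φ_n` vanishes at
every `u_j`. Rescaling to `(1, (F - 1)/(F + 1)) = (1, c⁻¹)` and rotating the coefficients by `c`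
(`szegoVec_rotate`) gives the initial vector `(1, 1)` of the orthogonal polynomials.

Two facts complete the argument. The equation has `n` simple roots, all on the circle
(`exists_circlePoints_isInterlacingSolution`). The zero set depends measurably on the coefficients
(`exists_measurable_zeroSet`). -/

theorem weight_nonneg {n : ℕ} (a : ComplexSphere n) (j : Fin n) : 0 ≤ weight a j :=
  sq_nonneg _

theorem weight_pos {n : ℕ} {a : ComplexSphere n} {j : Fin n}
    (h : (a : EuclideanSpace ℂ (Fin n)) j ≠ 0) : 0 < weight a j :=
  pow_pos (norm_pos_iff.2 h) 2

theorem sum_weight {n : ℕ} (a : ComplexSphere n) : ∑ j, weight a j = 1 := by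
  have h : ‖(a : EuclideanSpace ℂ (Fin n))‖ ^ 2 = 1 := by
    rw [norm_eq_of_mem_sphere a, one_pow]
  rwa [EuclideanSpace.norm_sq_eq] at h

theorem polyInner_spectralMeasure {n : ℕ} (u : Fin n → Circle) (a : ComplexSphere n)
    (p q : ℂ[X]) :
    polyInner (spectralMeasure u a) p q =
      ∑ j, (weight a j : ℂ) * (conj (p.eval (u j : ℂ)) * q.eval (u j : ℂ)) := by
  unfold polyInner spectralMeasure
  rw [integral_finsetSum_measure]
  · refine Finset.sum_congr rfl fun j _ => ?_
    rw [integral_smul_measure, integral_dirac, ENNReal.toReal_ofReal (weight_nonneg a j)]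
    simp
  · intro j _
    refine Integrable.smul_measure ?_ ENNReal.ofReal_ne_top
    exact integrable_dirac (by simp [ENNReal.mul_lt_top])

/-- The inner product against a fixed polynomial, as a linear form. -/
noncomputable def polyInnerRight {n : ℕ} (u : Fin n → Circle) (a : ComplexSphere n)
    (p : ℂ[X]) : ℂ[X] →ₗ[ℂ] ℂ :=
  ∑ j, ((weight a j : ℂ) * conj (p.eval (u j : ℂ))) • Polynomial.leval (u j : ℂ)

theorem polyInnerRight_apply {n : ℕ} (u : Fin n → Circle) (a : ComplexSphere n) (p q : ℂ[X]) :
    polyInnerRight u a p q = polyInner (spectralMeasure u a) p q := by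
  simp [polyInnerRight, polyInner_spectralMeasure, mul_assoc, Polynomial.leval]

section Discrete

variable {n : ℕ} (u : Fin n → Circle) (a : ComplexSphere n)

local notation "⟪" p ", " q "⟫" => polyInner (spectralMeasure u a) p q

theorem polyInner_conj (p q : ℂ[X]) : conj ⟪p, q⟫ = ⟪q, p⟫ := by
  simp only [polyInner_spectralMeasure, map_sum, map_mul, Complex.conj_ofReal, Complex.conj_conj]
  exact Finset.sum_congr rfl fun j _ => by ring

theorem polyInner_sub_right (p q r : ℂ[X]) : ⟪p, q - r⟫ = ⟪p, q⟫ - ⟪p, r⟫ := by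
  simp only [← polyInnerRight_apply, map_sub]

theorem polyInner_add_right (p q r : ℂ[X]) : ⟪p, q + r⟫ = ⟪p, q⟫ + ⟪p, r⟫ := by
  simp only [← polyInnerRight_apply, map_add]

theorem polyInner_C_mul_right (p q : ℂ[X]) (c : ℂ) : ⟪p, C c * q⟫ = c * ⟪p, q⟫ := by
  simp only [← polyInnerRight_apply, ← smul_eq_C_mul, map_smul, smul_eq_mul]

theorem polyInner_add_left (p q r : ℂ[X]) : ⟪p + q, r⟫ = ⟪p, r⟫ + ⟪q, r⟫ := by
  rw [← polyInner_conj, polyInner_add_right, map_add, polyInner_conj, polyInner_conj]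

theorem polyInner_C_mul_left (p q : ℂ[X]) (c : ℂ) : ⟪C c * p, q⟫ = conj c * ⟪p, q⟫ := by
  rw [← polyInner_conj, polyInner_C_mul_right, map_mul, polyInner_conj]

/-- Multiplication by `z` preserves the inner product because the nodes have modulus 1; the Szegő
recursion rests on this. -/
theorem polyInner_X_mul_X_mul (p q : ℂ[X]) : ⟪X * p, X * q⟫ = ⟪p, q⟫ := by
  simp only [polyInner_spectralMeasure, eval_mul, eval_X, map_mul]
  refine Finset.sum_congr rfl fun j _ => ?_
  have h : conj (u j : ℂ) * (u j : ℂ) = 1 := by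
    rw [mul_comm, Complex.mul_conj, Circle.normSq_coe, Complex.ofReal_one]
  linear_combination (weight a j : ℂ) * conj (p.eval (u j : ℂ)) * q.eval (u j : ℂ) * h

variable {u a}

theorem eval_eq_zero_of_polyInner_self (ha : ∀ j, (a : EuclideanSpace ℂ (Fin n)) j ≠ 0)
    {p : ℂ[X]} (h : ⟪p, p⟫ = 0) (j : Fin n) : p.eval (u j : ℂ) = 0 := by
  have h' : ∑ j, weight a j * Complex.normSq (p.eval (u j : ℂ)) = 0 := by
    rw [polyInner_spectralMeasure] at h
    have : ((∑ j, weight a j * Complex.normSq (p.eval (u j : ℂ)) : ℝ) : ℂ) = 0 := by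
      rw [← h]
      push_cast
      exact Finset.sum_congr rfl fun j _ => by rw [Complex.normSq_eq_conj_mul_self]
    exact_mod_cast this
  have h0 := (Finset.sum_eq_zero_iff_of_nonneg fun i _ =>
    mul_nonneg (weight_nonneg a i) (Complex.normSq_nonneg _)).1 h' j (Finset.mem_univ j)
  exact Complex.normSq_eq_zero.1 ((mul_eq_zero.1 h0).resolve_left (weight_pos (ha j)).ne')

theorem eq_zero_of_eval_nodes (hu : Function.Injective u) {p : ℂ[X]} (hp : p.degree < n)
    (h : ∀ j, p.eval (u j : ℂ) = 0) : p = 0 := by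
  by_contra h0
  refine h0 (Polynomial.eq_zero_of_natDegree_lt_card_of_eval_eq_zero p
    (f := fun j => (u j : ℂ)) (fun i j hij => hu (Circle.ext hij)) h ?_)
  rw [Fintype.card_fin]
  exact (Polynomial.natDegree_lt_iff_degree_lt h0).2 hp

theorem eq_zero_of_polyInner_self (ha : ∀ j, (a : EuclideanSpace ℂ (Fin n)) j ≠ 0)
    (hu : Function.Injective u) {p : ℂ[X]} (hp : p.degree < n) (h : ⟪p, p⟫ = 0) : p = 0 :=
  eq_zero_of_eval_nodes hu hp (eval_eq_zero_of_polyInner_self ha h)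

/-! ### Orthogonality of the Gram-Schmidt polynomials -/

/-- This needs nothing of `σ`: a vanishing denominator in Gram-Schmidt only removes a term of lower
degree, as `x / 0 = 0`. -/
theorem degree_monicOrthogonal_sub (σ : Measure Circle) (k : ℕ) :
    (monicOrthogonal σ k - X ^ k).degree < (k : WithBot ℕ) := by
  induction k using Nat.strong_induction_on with
  | _ k ih =>
    rw [monicOrthogonal, sub_sub_cancel_left, degree_neg]
    refine lt_of_le_of_lt (degree_sum_le _ _) ?_
    refine (Finset.sup_lt_iff (WithBot.bot_lt_coe k)).2 ?_
    intro j _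
    have hj : (monicOrthogonal σ j).degree ≤ (j : ℕ) := by
      have : monicOrthogonal σ j = (monicOrthogonal σ j - X ^ (j : ℕ)) + X ^ (j : ℕ) := by ring
      rw [this]
      exact (degree_add_le _ _).trans (max_le (ih j j.2).le (degree_X_pow_le _))
    rw [← smul_eq_C_mul]
    exact (degree_smul_le _ _).trans_lt (hj.trans_lt (Nat.cast_lt.2 j.2))

theorem monic_monicOrthogonal (σ : Measure Circle) (k : ℕ) : (monicOrthogonal σ k).Monic := by
  have := monic_X_pow_add (degree_monicOrthogonal_sub σ k)
  rwa [add_sub_cancel] at this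

theorem natDegree_monicOrthogonal (σ : Measure Circle) (k : ℕ) :
    (monicOrthogonal σ k).natDegree = k := by
  have h := degree_add_eq_left_of_degree_lt
    ((degree_monicOrthogonal_sub σ k).trans_eq (degree_X_pow (R := ℂ) k).symm)
  rw [add_sub_cancel, degree_X_pow] at h
  exact natDegree_eq_of_degree_eq_some h

theorem degree_monicOrthogonal (σ : Measure Circle) (k : ℕ) :
    (monicOrthogonal σ k).degree = k := by
  rw [degree_eq_natDegree (monic_monicOrthogonal σ k).ne_zero, natDegree_monicOrthogonal]

theorem Polynomial.degree_sub_lt_of_monic {p q : ℂ[X]} {k : ℕ} (hp : p.Monic) (hq : q.Monic)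
    (hpk : p.natDegree = k) (hqk : q.natDegree = k) : (p - q).degree < k := by
  rw [degree_lt_iff_coeff_zero]
  intro m hm
  rcases hm.eq_or_lt with rfl | hm
  · have h1 := hp.coeff_natDegree
    have h2 := hq.coeff_natDegree
    rw [hpk] at h1
    rw [hqk] at h2
    rw [coeff_sub, h1, h2, sub_self]
  · rw [coeff_sub, coeff_eq_zero_of_natDegree_lt (by omega),
      coeff_eq_zero_of_natDegree_lt (by omega), sub_self]

local notation "Φ" => monicOrthogonal (spectralMeasure u a)

theorem polyInner_monicOrthogonal_self_ne_zero
    (ha : ∀ j, (a : EuclideanSpace ℂ (Fin n)) j ≠ 0) (hu : Function.Injective u)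
    {k : ℕ} (hk : k < n) : ⟪Φ k, Φ k⟫ ≠ 0 := fun h =>
  (monic_monicOrthogonal _ k).ne_zero <| eq_zero_of_polyInner_self ha hu
    (by rw [degree_monicOrthogonal]; exact_mod_cast hk) h

/-- The case `k = n` is allowed because only the norms of `Φ_i` with `i < k` are divided by. -/
theorem polyInner_monicOrthogonal_of_lt
    (ha : ∀ j, (a : EuclideanSpace ℂ (Fin n)) j ≠ 0) (hu : Function.Injective u)
    {k : ℕ} (hk : k ≤ n) : ∀ i < k, ⟪Φ i, Φ k⟫ = 0 := by
  induction k using Nat.strong_induction_on with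
  | _ k ih =>
    intro i hi
    rw [monicOrthogonal.eq_1 _ k, polyInner_sub_right, ← polyInnerRight_apply, ← polyInnerRight_apply,
      map_sum]
    simp only [polyInnerRight_apply, polyInner_C_mul_right]
    rw [Finset.sum_eq_single (⟨i, hi⟩ : Fin k)]
    · rw [div_mul_cancel₀ _ (polyInner_monicOrthogonal_self_ne_zero ha hu (hi.trans_le hk)),
        sub_self]
    · intro j _ hj
      have hij : (j : ℕ) ≠ i := fun h => hj (Fin.ext h)
      rcases lt_or_gt_of_ne hij with h | h
      · rw [← polyInner_conj u a (Φ j) (Φ i), ih i hi (by omega) j h, map_zero, mul_zero]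
      · rw [ih j j.2 (by omega) i h, mul_zero]
    · intro h
      exact absurd (Finset.mem_univ _) h

theorem polyInner_monicOrthogonal_of_degree_lt
    (ha : ∀ j, (a : EuclideanSpace ℂ (Fin n)) j ≠ 0) (hu : Function.Injective u)
    {k : ℕ} (hk : k ≤ n) {q : ℂ[X]} (hq : q.degree < k) : ⟪q, Φ k⟫ = 0 := by
  suffices H : ∀ m ≤ k, ∀ q : ℂ[X], q.degree < m → ⟪q, Φ k⟫ = 0 from H k le_rfl q hq
  intro m
  induction m with
  | zero =>
    intro _ q hq
    have : q = 0 := degree_eq_bot.1 (by simpa [Nat.WithBot.lt_zero_iff] using hq)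
    subst this
    simp [polyInner_spectralMeasure]
  | succ m ih =>
    intro hm q hq
    have hdecomp : q = (q - C (q.coeff m) * Φ m) + C (q.coeff m) * Φ m := by ring
    rw [hdecomp, polyInner_add_left, polyInner_C_mul_left,
      polyInner_monicOrthogonal_of_lt ha hu hk m (by omega), mul_zero, add_zero]
    refine ih (by omega) _ ?_
    rw [degree_lt_iff_coeff_zero] at hq ⊢
    intro l hl
    rw [coeff_sub, coeff_C_mul]
    rcases hl.eq_or_lt with rfl | hl
    · have := (monic_monicOrthogonal (spectralMeasure u a) m).coeff_natDegree
      rw [natDegree_monicOrthogonal] at this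
      rw [this, mul_one, sub_self]
    · rw [hq l (by omega), coeff_eq_zero_of_natDegree_lt (p := Φ m)
        (by rw [natDegree_monicOrthogonal]; omega), mul_zero, sub_self]

/-- Let `N` be the nodal polynomial. `Φ_n` is orthogonal to `Φ_n - N`, which has lower degree, and
to `N`, which is zero in `L²(σ)`. Hence `Φ_n` has norm zero. -/
theorem monicOrthogonal_eval_node
    (ha : ∀ j, (a : EuclideanSpace ℂ (Fin n)) j ≠ 0) (hu : Function.Injective u)
    (j : Fin n) : (Φ n).eval (u j : ℂ) = 0 := by
  refine eval_eq_zero_of_polyInner_self ha ?_ j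
  set N : ℂ[X] := ∏ i, (X - C (u i : ℂ)) with hN
  have hmon : N.Monic := monic_prod_X_sub_C _ _
  have hdeg : N.natDegree = n := by
    rw [hN, natDegree_prod_of_monic _ _ fun i _ => monic_X_sub_C _]
    simp
  have h1 : ⟪Φ n - N, Φ n⟫ = 0 := polyInner_monicOrthogonal_of_degree_lt ha hu le_rfl
    (degree_sub_lt_of_monic (monic_monicOrthogonal _ n) hmon (natDegree_monicOrthogonal _ n) hdeg)
  have h2 : ⟪N, Φ n⟫ = 0 := by
    rw [polyInner_spectralMeasure]
    refine Finset.sum_eq_zero fun i _ => ?_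
    have : N.eval (u i : ℂ) = 0 := by
      rw [hN, eval_prod]
      exact Finset.prod_eq_zero (Finset.mem_univ i) (by simp)
    rw [this]
    simp
  have h3 : Φ n = (Φ n - N) + N := by ring
  calc ⟪Φ n, Φ n⟫ = ⟪(Φ n - N) + N, Φ n⟫ := by rw [← h3]
    _ = 0 := by rw [polyInner_add_left, h1, h2, add_zero]

end Discrete

/-! ### The Szegő recursion -/

/-- The pair `(Φ_k, Φ_k^*)` built from the coefficients `α` by the Szegő recursion. -/
noncomputable def szegoPoly (α : ℕ → ℂ) : ℕ → ℂ[X] × ℂ[X]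
  | 0 => (1, 1)
  | k + 1 => (X * (szegoPoly α k).1 - C (conj (α k)) * (szegoPoly α k).2,
      (szegoPoly α k).2 - C (α k) * (X * (szegoPoly α k).1))

/-- The Szegő recursion at a point `z`, with an arbitrary initial vector. -/
noncomputable def szegoVec (α : ℕ → ℂ) (z : ℂ) (v : ℂ × ℂ) : ℕ → ℂ × ℂ
  | 0 => v
  | k + 1 => (z * (szegoVec α z v k).1 - conj (α k) * (szegoVec α z v k).2,
      (szegoVec α z v k).2 - α k * (z * (szegoVec α z v k).1))

theorem eval_szegoPoly (α : ℕ → ℂ) (z : ℂ) (k : ℕ) :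
    ((szegoPoly α k).1.eval z, (szegoPoly α k).2.eval z) = szegoVec α z (1, 1) k := by
  induction k with
  | zero => simp [szegoPoly, szegoVec]
  | succ k ih => simp [szegoPoly, szegoVec, ← ih]

theorem szegoVec_congr {α β : ℕ → ℂ} (z : ℂ) (v : ℂ × ℂ) {n : ℕ} (h : ∀ k < n, α k = β k) :
    szegoVec α z v n = szegoVec β z v n := by
  induction n with
  | zero => rfl
  | succ n ih => simp only [szegoVec, ih fun k hk => h k (by omega), h n (by omega)]

theorem szegoVec_smul (α : ℕ → ℂ) (z c : ℂ) (v : ℂ × ℂ) (k : ℕ) :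
    szegoVec α z (c • v) k = c • szegoVec α z v k := by
  induction k with
  | zero => rfl
  | succ k ih =>
    simp only [szegoVec, ih, Prod.smul_mk, Prod.smul_fst, Prod.smul_snd, smul_eq_mul,
      Prod.mk.injEq]
    constructor <;> ring

/-- Multiplying all coefficients by `c` conjugates each transfer matrix by `diag(1, c)`. -/
theorem szegoVec_rotate (α : ℕ → ℂ) (z : ℂ) (c : Circle) (x y : ℂ) (k : ℕ) :
    szegoVec (fun i => c * α i) z (x, c * y) k =
      ((szegoVec α z (x, y) k).1, c * (szegoVec α z (x, y) k).2) := by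
  have hc : conj (c : ℂ) * c = 1 := by
    rw [mul_comm, Complex.mul_conj, Circle.normSq_coe, Complex.ofReal_one]
  induction k with
  | zero => rfl
  | succ k ih =>
    simp only [szegoVec, ih, map_mul, Prod.mk.injEq]
    constructor
    · linear_combination (-conj (α k) * (szegoVec α z (x, y) k).2) * hc
    · ring

theorem monic_natDegree_szegoPoly (α : ℕ → ℂ) (k : ℕ) :
    ((szegoPoly α k).1.Monic ∧ (szegoPoly α k).1.natDegree = k) ∧
      (szegoPoly α k).2.natDegree ≤ k := by
  induction k with
  | zero => simp [szegoPoly]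
  | succ k ih =>
    obtain ⟨⟨h1, h2⟩, h3⟩ := ih
    have hX : (X * (szegoPoly α k).1).natDegree = k + 1 := by
      rw [natDegree_X_mul h1.ne_zero, h2]
    have hlt : (C (conj (α k)) * (szegoPoly α k).2).natDegree < k + 1 :=
      (natDegree_C_mul_le _ _).trans_lt (by omega)
    have hdeg : (C (conj (α k)) * (szegoPoly α k).2).degree
        < (X * (szegoPoly α k).1).degree := degree_lt_degree (by rw [hX]; exact hlt)
    refine ⟨⟨?_, ?_⟩, ?_⟩
    · exact (monic_X.mul h1).sub_of_left hdeg
    · simp only [szegoPoly]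
      rw [natDegree_sub_eq_left_of_natDegree_lt (by rw [hX]; exact hlt), hX]
    · simp only [szegoPoly]
      refine (natDegree_sub_le _ _).trans (max_le (by omega) ?_)
      exact (natDegree_C_mul_le _ _).trans hX.le

theorem monic_szegoPoly (α : ℕ → ℂ) (k : ℕ) : (szegoPoly α k).1.Monic :=
  (monic_natDegree_szegoPoly α k).1.1

theorem natDegree_szegoPoly (α : ℕ → ℂ) (k : ℕ) : (szegoPoly α k).1.natDegree = k :=
  (monic_natDegree_szegoPoly α k).1.2

theorem eval_zero_szegoPoly_snd (α : ℕ → ℂ) (k : ℕ) : (szegoPoly α k).2.eval 0 = 1 := by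
  induction k with
  | zero => simp [szegoPoly]
  | succ k ih => simp [szegoPoly, ih]

/-- On the circle the second component is the reversed polynomial of the first. -/
theorem eval_szegoPoly_snd_circle (α : ℕ → ℂ) (k : ℕ) (t : Circle) :
    (szegoPoly α k).2.eval (t : ℂ) = (t : ℂ) ^ k * conj ((szegoPoly α k).1.eval (t : ℂ)) := by
  have ht : conj (t : ℂ) * t = 1 := by
    rw [mul_comm, Complex.mul_conj, Circle.normSq_coe, Complex.ofReal_one]
  have htk (k : ℕ) : conj (t : ℂ) ^ k * (t : ℂ) ^ k = 1 := by rw [← mul_pow, ht, one_pow]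
  induction k with
  | zero => simp [szegoPoly]
  | succ k ih =>
    simp only [szegoPoly, eval_sub, eval_mul, eval_X, eval_C, ih, map_sub, map_mul,
      Complex.conj_conj, map_pow]
    set x := (szegoPoly α k).1.eval (t : ℂ)
    rw [pow_succ]
    linear_combination (-(t : ℂ) ^ k * conj x) * ht + α k * t * x * htk k

section Spectral

variable {n : ℕ} {u : Fin n → Circle} {a : ComplexSphere n}

local notation "⟪" p ", " q "⟫" => polyInner (spectralMeasure u a) p q
local notation "Φ" => monicOrthogonal (spectralMeasure u a)
local notation "φ" => szegoPoly (verblunsky (spectralMeasure u a))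

/-- The monic orthogonal polynomials satisfy the Szegő recursion. -/
theorem szegoPoly_verblunsky
    (ha : ∀ j, (a : EuclideanSpace ℂ (Fin n)) j ≠ 0) (hu : Function.Injective u)
    {k : ℕ} (hk : k ≤ n) : (φ k).1 = Φ k := by
  induction k with
  | zero => rw [monicOrthogonal]; simp [szegoPoly]
  | succ k ih =>
    specialize ih (by omega)
    set α := verblunsky (spectralMeasure u a)
    set D := Φ (k + 1) - (φ (k + 1)).1 with hD
    have hDdeg : D.degree < (k + 1 : ℕ) := degree_sub_lt_of_monic (monic_monicOrthogonal _ _)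
      (monic_szegoPoly _ _) (natDegree_monicOrthogonal _ _) (natDegree_szegoPoly _ _)
    -- The Verblunsky coefficient is exactly what makes the constant terms agree, so `D = X E` with
    -- `deg E < k`.
    have hD0 : D.eval 0 = 0 := by
      simp [hD, szegoPoly, eval_zero_szegoPoly_snd, verblunsky]
    obtain ⟨E, hE⟩ : X ∣ D := X_dvd_iff.2 (by rwa [coeff_zero_eq_eval_zero])
    have hEdeg : E.degree < k := by
      rw [degree_lt_iff_coeff_zero] at hDdeg ⊢
      intro m hm
      rw [← coeff_X_mul, ← hE]
      exact hDdeg _ (by omega)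
    have h1 : ⟪D, Φ (k + 1)⟫ = 0 := polyInner_monicOrthogonal_of_degree_lt ha hu hk hDdeg
    have h2 : ⟪D, X * (φ k).1⟫ = 0 := by
      rw [hE, polyInner_X_mul_X_mul, ih]
      exact polyInner_monicOrthogonal_of_degree_lt ha hu (by omega) hEdeg
    have h3 : ⟪D, (φ k).2⟫ = 0 := by
      -- `R` is the polynomial equal to `z^k conj(z E(z))` on the circle. It turns the pairing of
      -- `D` with the reversed polynomial into a pairing of `Φ_k` with degree less than `k`.
      set R : ℂ[X] := ∑ i ∈ Finset.range k, C (conj (E.coeff i)) * X ^ (k - 1 - i) with hR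
      have hRdeg : R.degree < k := by
        refine lt_of_le_of_lt (degree_sum_le _ _)
          ((Finset.sup_lt_iff (WithBot.bot_lt_coe k)).2 fun i hi => ?_)
        refine (degree_C_mul_X_pow_le _ _).trans_lt ?_
        have := Finset.mem_range.1 hi
        exact Nat.cast_lt.2 (by omega)
      have hEval (t : Circle) : conj ((t : ℂ) * E.eval (t : ℂ)) * (t : ℂ) ^ k
          = R.eval (t : ℂ) := by
        have ht : conj (t : ℂ) * t = 1 := by
          rw [mul_comm, Complex.mul_conj, Circle.normSq_coe, Complex.ofReal_one]
        by_cases h0 : E = 0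
        · simp [hR, h0]
        rw [eval_eq_sum_range' ((natDegree_lt_iff_degree_lt h0).2 hEdeg), hR,
          eval_finsetSum, Finset.mul_sum, map_sum, Finset.sum_mul]
        refine Finset.sum_congr rfl fun i hi => ?_
        have hi := Finset.mem_range.1 hi
        have hk' : (t : ℂ) ^ k = (t : ℂ) ^ (i + 1) * (t : ℂ) ^ (k - 1 - i) := by
          rw [← pow_add]
          congr 1
          omega
        have hti : conj (t : ℂ) ^ (i + 1) * (t : ℂ) ^ (i + 1) = 1 := by
          rw [← mul_pow, ht, one_pow]
        simp only [map_mul, map_pow, eval_mul, eval_C, eval_pow, eval_X, hk']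
        linear_combination conj (E.coeff i) * (t : ℂ) ^ (k - 1 - i) * hti
      have h := polyInner_monicOrthogonal_of_degree_lt ha hu (k := k) (by omega) hRdeg
      rw [← polyInner_conj, map_eq_zero, ← ih] at h
      rw [← h, polyInner_spectralMeasure, polyInner_spectralMeasure]
      refine Finset.sum_congr rfl fun j _ => ?_
      rw [eval_szegoPoly_snd_circle, ← hEval, hE, eval_mul, eval_X]
      ring
    -- `D` is a combination of three polynomials to each of which it is orthogonal.
    have h4 : ⟪D, D⟫ = 0 := by
      calc ⟪D, D⟫ = ⟪D, Φ (k + 1) - (X * (φ k).1 - C (conj (α k)) * (φ k).2)⟫ := rfl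
        _ = 0 := by
          rw [polyInner_sub_right, polyInner_sub_right, polyInner_C_mul_right, h1, h2, h3]
          simp
    have : D = 0 := eq_zero_of_polyInner_self ha hu
      (hDdeg.trans_le (by exact_mod_cast hk)) h4
    exact (sub_eq_zero.1 this).symm

end Spectral

/-! ### Rotated coefficients and the interlacing equation -/

/-- `(ih - 1) / (ih + 1)`, the factor of the Verblunsky coefficients attached to the level `h`. -/
noncomputable def cayleyCircle (h : ℝ) : Circle :=
  ⟨(Complex.I * h - 1) / (Complex.I * h + 1), by
    have h0 : Complex.I * h + 1 ≠ 0 := fun hz => by simpa using congrArg Complex.re hz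
    change _ ∈ Metric.sphere (0 : ℂ) 1
    rw [mem_sphere_zero_iff_norm, norm_div, div_eq_one_iff_eq (norm_ne_zero_iff.2 h0),
      ← Complex.norm_conj]
    simp only [map_sub, map_mul, Complex.conj_I, Complex.conj_ofReal, map_one]
    rw [← norm_neg]
    ring_nf⟩

theorem coe_cayleyCircle (h : ℝ) :
    (cayleyCircle h : ℂ) = (Complex.I * h - 1) / (Complex.I * h + 1) := rfl

theorem Polynomial.Monic.eq_prod_of_eval_circle {n : ℕ} {p : ℂ[X]} (hp : p.Monic)
    (hdeg : p.natDegree = n) {v : Fin n → Circle} (hv : Function.Injective v)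
    (h : ∀ j, p.eval (v j : ℂ) = 0) : p = ∏ j, (X - C (v j : ℂ)) := by
  have hmon : (∏ i, (X - C (v i : ℂ))).Monic := monic_prod_X_sub_C _ _
  have hd : (∏ i, (X - C (v i : ℂ))).natDegree = n := by
    rw [natDegree_prod_of_monic _ _ fun i _ => monic_X_sub_C _]
    simp
  refine sub_eq_zero.1 (eq_zero_of_eval_nodes hv (degree_sub_lt_of_monic hp hmon hdeg hd)
    fun j => ?_)
  rw [eval_sub, h j, eval_prod, Finset.prod_eq_zero (Finset.mem_univ j) (by simp), sub_zero]

section Spectral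

variable {n : ℕ} {u : Fin n → Circle} {a : ComplexSphere n}

local notation "⟪" p ", " q "⟫" => polyInner (spectralMeasure u a) p q
local notation "Φ" => monicOrthogonal (spectralMeasure u a)
local notation "φ" => szegoPoly (verblunsky (spectralMeasure u a))

theorem szegoVec_spectralMeasure
    (ha : ∀ j, (a : EuclideanSpace ℂ (Fin n)) j ≠ 0) (hu : Function.Injective u)
    {z F : ℂ} (hz : ∀ j, z ≠ u j)
    (hF : F = ∑ j, (weight a j : ℂ) * (((u j : ℂ) + z) / ((u j : ℂ) - z)))
    {k : ℕ} (hk : k ≤ n) :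
    szegoVec (verblunsky (spectralMeasure u a)) z (F + 1, F - 1) k =
      (∑ j, (weight a j : ℂ) * (((u j : ℂ) + z) / ((u j : ℂ) - z)) * (φ k).1.eval (u j : ℂ)
          + ∑ j, (weight a j : ℂ) * (φ k).1.eval (u j : ℂ),
        ∑ j, (weight a j : ℂ) * (((u j : ℂ) + z) / ((u j : ℂ) - z)) * (φ k).2.eval (u j : ℂ)
          - ∑ j, (weight a j : ℂ) * (φ k).2.eval (u j : ℂ)) := by
  induction k with
  | zero =>
    have h1 : ∑ j, (weight a j : ℂ) = 1 := by exact_mod_cast sum_weight a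
    simp [szegoPoly, szegoVec, h1, hF]
  | succ k ih =>
    specialize ih (by omega)
    -- With `K = (u + z)/(u - z)`, the relation `K (u - z) = u + z` makes the second components
    -- agree term by term. The first components differ by twice this sum, which vanishes since
    -- `Φ_{k+1}` is orthogonal to 1.
    have hM : ∑ j, (weight a j : ℂ) * (φ (k + 1)).1.eval (u j : ℂ) = 0 := by
      have h := polyInner_monicOrthogonal_of_degree_lt ha hu hk (q := 1) (by
        rw [degree_one]
        exact Nat.cast_lt.2 k.succ_pos)
      rw [polyInner_spectralMeasure, ← szegoPoly_verblunsky ha hu hk] at h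
      simpa using h
    have hK (j : Fin n) : ((u j : ℂ) + z) / ((u j : ℂ) - z) * ((u j : ℂ) - z) = u j + z :=
      div_mul_cancel₀ _ (sub_ne_zero.2 (hz j).symm)
    simp only [szegoVec, ih, Prod.mk.injEq]
    simp only [szegoPoly, eval_sub, eval_mul, eval_X, eval_C] at hM ⊢
    constructor
    · have h2 := congrArg (fun x => 2 * x) hM
      simp only [mul_zero] at h2
      symm
      rw [← sub_eq_zero, ← h2]
      simp only [Finset.mul_sum, ← Finset.sum_add_distrib, ← Finset.sum_sub_distrib]
      refine Finset.sum_congr rfl fun j _ => ?_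
      linear_combination (weight a j : ℂ) * (φ k).1.eval (u j : ℂ) * hK j
    · symm
      rw [← sub_eq_zero]
      simp only [Finset.mul_sum, ← Finset.sum_add_distrib, ← Finset.sum_sub_distrib]
      refine Finset.sum_eq_zero fun j _ => ?_
      linear_combination (-(weight a j : ℂ) * verblunsky (spectralMeasure u a) k
        * (φ k).1.eval (u j : ℂ)) * hK j

theorem eval_szegoPoly_of_isInterlacingSolution
    (ha : ∀ j, (a : EuclideanSpace ℂ (Fin n)) j ≠ 0) (hu : Function.Injective u)
    {h : ℝ} {z : ℂ} (hz : IsInterlacingSolution u (weight a) h z) :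
    (szegoPoly (fun k => cayleyCircle h * verblunsky (spectralMeasure u a) k) n).1.eval z
      = 0 := by
  obtain ⟨hzu, heq⟩ := hz
  set F := ∑ j, (weight a j : ℂ) * (((u j : ℂ) + z) / ((u j : ℂ) - z)) with hF
  have hFh : F = -(Complex.I * h) := by
    have : Complex.I * F = h := by
      rw [← heq, hF, Finset.mul_sum]
      exact Finset.sum_congr rfl fun j _ => by ring
    rw [← this, ← mul_assoc, Complex.I_mul_I]
    ring
  have h0 : Complex.I * h + 1 ≠ 0 := fun hz => by simpa using congrArg Complex.re hz
  have h1 : 1 - Complex.I * h ≠ 0 := fun hz => by simpa using congrArg Complex.re hz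
  -- The initial direction is `(1, y)`. Since `F = -ih`, `y` is the inverse of `cayleyCircle h`, so
  -- the rotation sends it to `(1, 1)`.
  set y : ℂ := (F - 1) / (F + 1) with hy
  have hly : (cayleyCircle h : ℂ) * y = 1 := by
    have h2 : -(Complex.I * h) + 1 ≠ 0 := by rwa [neg_add_eq_sub]
    rw [hy, hFh, coe_cayleyCircle]
    field_simp
    ring
  have hF1 : F + 1 ≠ 0 := by rwa [hFh, neg_add_eq_sub]
  have hsmul : ((F + 1, F - 1) : ℂ × ℂ) = (F + 1) • ((1, y) : ℂ × ℂ) := by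
    rw [Prod.smul_mk, smul_eq_mul, smul_eq_mul, mul_one, hy, mul_div_cancel₀ _ hF1]
  have hvec := szegoVec_spectralMeasure ha hu hzu hF le_rfl
  rw [hsmul, szegoVec_smul] at hvec
  have hvec := congrArg Prod.fst hvec
  simp only [szegoPoly_verblunsky ha hu le_rfl, monicOrthogonal_eval_node ha hu, mul_zero,
    Finset.sum_const_zero, add_zero, Prod.smul_fst, smul_eq_mul, mul_eq_zero, hF1,
    false_or] at hvec
  have hrot := szegoVec_rotate (verblunsky (spectralMeasure u a)) z (cayleyCircle h) 1 y n
  rw [hly, ← eval_szegoPoly] at hrot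
  rw [(Prod.mk.inj hrot).1, hvec]

/-! ### The interlacing equation has `n` solutions, on the circle -/

/-- The `j`-th term has imaginary part `ρ_j (1 - |z|²)/|u_j - z|²`. These all have the sign of `1 -
|z|²`, while their sum is the imaginary part of a real number. -/
theorem norm_eq_one_of_isInterlacingSolution
    (hn : 0 < n) (ha : ∀ j, (a : EuclideanSpace ℂ (Fin n)) j ≠ 0)
    {h : ℝ} {z : ℂ} (hz : IsInterlacingSolution u (weight a) h z) : ‖z‖ = 1 := by
  obtain ⟨hzu, heq⟩ := hz
  have him := congrArg Complex.im heq
  rw [Complex.im_sum, Complex.ofReal_im] at him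
  have hterm (j : Fin n) :
      (Complex.I * (weight a j : ℂ) * (((u j : ℂ) + z) / ((u j : ℂ) - z))).im =
        (1 - Complex.normSq z) * (weight a j / Complex.normSq ((u j : ℂ) - z)) := by
    have h1 : (u j : ℂ).re * (u j : ℂ).re + (u j : ℂ).im * (u j : ℂ).im = 1 := by
      rw [← Complex.normSq_apply, Circle.normSq_coe]
    have h2 : (Complex.I * (weight a j : ℂ) * (((u j : ℂ) + z) / ((u j : ℂ) - z))).im =
        weight a j * (((u j : ℂ) + z) / ((u j : ℂ) - z)).re := by simp
    rw [h2, Complex.div_re, Complex.normSq_apply z, ← add_div, mul_div_assoc', mul_div_assoc']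
    congr 1
    simp only [Complex.add_re, Complex.sub_re, Complex.add_im, Complex.sub_im]
    linear_combination (weight a j) * h1
  simp only [hterm, ← Finset.mul_sum] at him
  have hpos : 0 < ∑ j, weight a j / Complex.normSq ((u j : ℂ) - z) := by
    have : Nonempty (Fin n) := ⟨⟨0, hn⟩⟩
    exact Finset.sum_pos (fun j _ => div_pos (weight_pos (ha j))
      (Complex.normSq_pos.2 (sub_ne_zero.2 (hzu j).symm))) Finset.univ_nonempty
  have h1 : Complex.normSq z = 1 := by
    have := (mul_eq_zero.1 him).resolve_right hpos.ne'
    linarith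
  rw [Complex.normSq_eq_norm_sq] at h1
  exact (pow_eq_one_iff_of_nonneg (norm_nonneg z) two_ne_zero).1 h1

/-- The polynomial whose roots are the solutions of the interlacing equation. -/
noncomputable def interlacingPoly (u : Fin n → Circle) (ρ : Fin n → ℝ) (h : ℝ) : ℂ[X] :=
  C (Complex.I * h - 1) * ∏ j, (X - C (u j : ℂ)) -
    ∑ j, C (2 * (ρ j : ℂ) * u j) * ∏ i ∈ Finset.univ.erase j, (X - C (u i : ℂ))

/-- Since `(u + z)/(u - z) = -1 - 2u/(z - u)` and the weights sum to 1, the second factor is `ih +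
F(z)` when `ρ = weight a`. -/
theorem eval_interlacingPoly (ρ : Fin n → ℝ) (h : ℝ) {z : ℂ} (hz : ∀ j, z ≠ u j) :
    (interlacingPoly u ρ h).eval z = (∏ j, (z - u j)) *
      ((Complex.I * h - 1) - ∑ j, 2 * (ρ j : ℂ) * u j * (z - u j)⁻¹) := by
  simp only [interlacingPoly, eval_sub, eval_mul, eval_C, eval_prod, eval_X, eval_finsetSum]
  rw [mul_sub, mul_comm (∏ j, _), Finset.mul_sum]
  congr 1
  refine Finset.sum_congr rfl fun j _ => ?_
  rw [← Finset.mul_prod_erase _ _ (Finset.mem_univ j)]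
  have := sub_ne_zero.2 (hz j)
  field_simp

/-- For positive weights and distinct nodes this is nonzero, so clearing denominators creates no
spurious root. -/
theorem eval_interlacingPoly_node (ρ : Fin n → ℝ) (h : ℝ) (j : Fin n) :
    (interlacingPoly u ρ h).eval (u j : ℂ) =
      -(2 * (ρ j : ℂ) * u j * ∏ i ∈ Finset.univ.erase j, ((u j : ℂ) - u i)) := by
  simp only [interlacingPoly, eval_sub, eval_mul, eval_C, eval_prod, eval_X, eval_finsetSum]
  rw [Finset.prod_eq_zero (Finset.mem_univ j) (sub_self _), mul_zero, zero_sub,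
    Finset.sum_eq_single j]
  · intro i _ hij
    rw [Finset.prod_eq_zero (Finset.mem_erase.2 ⟨hij.symm, Finset.mem_univ j⟩) (sub_self _),
      mul_zero]
  · exact fun hj => absurd (Finset.mem_univ j) hj

theorem natDegree_interlacingPoly (hn : 0 < n) (ρ : Fin n → ℝ) (h : ℝ) :
    (interlacingPoly u ρ h).natDegree = n := by
  have h0 : Complex.I * h - 1 ≠ 0 := fun hz => by simpa using congrArg Complex.re hz
  have h1 : (C (Complex.I * h - 1) * ∏ j, (X - C (u j : ℂ))).natDegree = n := by
    rw [natDegree_C_mul h0, natDegree_prod_of_monic _ _ fun i _ => monic_X_sub_C _]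
    simp
  unfold interlacingPoly
  rw [natDegree_sub_eq_left_of_natDegree_lt, h1]
  rw [h1]
  refine lt_of_le_of_lt (natDegree_sum_le_of_forall_le _ _ (n := n - 1) fun j _ => ?_)
    (by omega)
  refine (natDegree_C_mul_le _ _).trans ?_
  rw [natDegree_prod_of_monic _ _ fun i _ => monic_X_sub_C _]
  simp

theorem isInterlacingSolution_iff
    (ha : ∀ j, (a : EuclideanSpace ℂ (Fin n)) j ≠ 0) (hu : Function.Injective u)
    {h : ℝ} {z : ℂ} :
    IsInterlacingSolution u (weight a) h z ↔ (interlacingPoly u (weight a) h).eval z = 0 := by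
  by_cases hz : ∀ j, z ≠ u j
  · rw [eval_interlacingPoly _ _ hz, mul_eq_zero, or_iff_right
      (Finset.prod_ne_zero_iff.2 fun j _ => sub_ne_zero.2 (hz j)), IsInterlacingSolution,
      and_iff_right hz]
    have h1 : ∑ j, (weight a j : ℂ) = 1 := by exact_mod_cast sum_weight a
    have h2 : ∑ j, Complex.I * (weight a j : ℂ) * (((u j : ℂ) + z) / ((u j : ℂ) - z)) =
        Complex.I * (-1 - ∑ j, 2 * (weight a j : ℂ) * u j * (z - u j)⁻¹) := by
      rw [← h1, ← Finset.sum_neg_distrib, ← Finset.sum_sub_distrib, Finset.mul_sum]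
      refine Finset.sum_congr rfl fun j _ => ?_
      have h3 := sub_ne_zero.2 (hz j)
      have h4 := sub_ne_zero.2 (hz j).symm
      field_simp
      ring
    rw [h2]
    constructor
    · intro h3
      linear_combination (-Complex.I) * h3 +
        (-1 - ∑ j, 2 * (weight a j : ℂ) * u j * (z - u j)⁻¹) * Complex.I_mul_I
    · intro h3
      linear_combination Complex.I * h3 - (h : ℂ) * Complex.I_mul_I
  · push Not at hz
    obtain ⟨j, rfl⟩ := hz
    refine iff_of_false (fun hs => hs.1 j rfl) ?_
    rw [eval_interlacingPoly_node, neg_eq_zero]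
    refine mul_ne_zero (mul_ne_zero (mul_ne_zero two_ne_zero ?_) (Circle.coe_ne_zero _)) ?_
    · exact_mod_cast (weight_pos (ha j)).ne'
    · refine Finset.prod_ne_zero_iff.2 fun i hi => sub_ne_zero.2 fun hij => ?_
      exact (Finset.mem_erase.1 hi).1 (hu (Circle.ext hij)).symm

theorem eval_derivative_interlacingPoly_ne_zero
    (hn : 0 < n) (ha : ∀ j, (a : EuclideanSpace ℂ (Fin n)) j ≠ 0) (hu : Function.Injective u)
    {h : ℝ} {z : ℂ} (hz : (interlacingPoly u (weight a) h).eval z = 0) :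
    (derivative (interlacingPoly u (weight a) h)).eval z ≠ 0 := by
  have hsol := (isInterlacingSolution_iff ha hu).2 hz
  have hnorm := norm_eq_one_of_isInterlacingSolution hn ha hsol
  have hzu := hsol.1
  set N : ℂ → ℂ := fun w => ∏ j, (w - u j) with hN
  set f : ℂ → ℂ := fun w =>
    (Complex.I * h - 1) - ∑ j, 2 * (weight a j : ℂ) * u j * (w - u j)⁻¹ with hf
  have hNz : N z ≠ 0 := Finset.prod_ne_zero_iff.2 fun j _ => sub_ne_zero.2 (hzu j)
  have hfz : f z = 0 := by
    rw [eval_interlacingPoly _ _ hzu] at hz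
    exact (mul_eq_zero.1 hz).resolve_left hNz
  have hev : (fun w => (interlacingPoly u (weight a) h).eval w) =ᶠ[nhds z] fun w => N w * f w := by
    have : ∀ᶠ w in nhds z, ∀ j, w ≠ (u j : ℂ) :=
      Filter.eventually_all.2 fun j => isOpen_ne.mem_nhds (hzu j)
    filter_upwards [this] with w hw
    exact eval_interlacingPoly _ _ hw
  have hNd : DifferentiableAt ℂ N z := by
    have : N = fun w => (∏ j, (X - C (u j : ℂ))).eval w := by
      ext w
      simp [hN, eval_prod]
    rw [this]
    exact Polynomial.differentiableAt _
  have hfd : HasDerivAt f (∑ j, 2 * (weight a j : ℂ) * u j / (z - u j) ^ 2) z := by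
    have h1 : HasDerivAt (fun w : ℂ => ∑ j, 2 * (weight a j : ℂ) * u j * (w - u j)⁻¹)
        (∑ j, 2 * (weight a j : ℂ) * u j * (-1 / (z - u j) ^ 2)) z := by
      refine HasDerivAt.fun_sum fun j _ => ?_
      exact (((hasDerivAt_id z).sub_const _).inv (sub_ne_zero.2 (hzu j))).const_mul _
    refine (h1.const_sub (Complex.I * h - 1)).congr_deriv ?_
    rw [← Finset.sum_neg_distrib]
    exact Finset.sum_congr rfl fun j _ => by ring
  have hd := (Polynomial.hasDerivAt (interlacingPoly u (weight a) h) z).unique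
    ((hNd.hasDerivAt.mul hfd).congr_of_eventuallyEq hev)
  rw [hd, hfz, mul_zero, zero_add]
  refine mul_ne_zero hNz fun h0 => ?_
  -- At a root the derivative is `N f'`. For `z` and `u` on the circle, `z u/(z - u)² = -1/|z -
  -- u|²`, so `z f'(z)` is a negative real and the root is simple.
  have hsum : z * ∑ j, 2 * (weight a j : ℂ) * u j / (z - u j) ^ 2 =
      ((-∑ j, 2 * weight a j / Complex.normSq (z - u j) : ℝ) : ℂ) := by
    push_cast
    rw [← Finset.sum_neg_distrib, Finset.mul_sum]
    refine Finset.sum_congr rfl fun j _ => ?_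
    have h1 : (u j : ℂ) * conj (u j : ℂ) = 1 := by
      rw [Complex.mul_conj, Circle.normSq_coe, Complex.ofReal_one]
    have h2 : z * conj z = 1 := by
      rw [Complex.mul_conj, Complex.normSq_eq_norm_sq, hnorm]
      simp
    have h3 : z - u j ≠ 0 := sub_ne_zero.2 (hzu j)
    have h4 : conj (z - u j) ≠ 0 := (_root_.map_ne_zero _).2 h3
    rw [← Complex.mul_conj]
    have h5 : z * u j * conj (z - u j) = -(z - u j) := by
      rw [map_sub]
      linear_combination (u j : ℂ) * h2 - z * h1
    field_simp
    linear_combination (weight a j : ℂ) * h5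
  rw [h0, mul_zero] at hsum
  have hpos : 0 < ∑ j, 2 * weight a j / Complex.normSq (z - u j) := by
    have : Nonempty (Fin n) := ⟨⟨0, hn⟩⟩
    exact Finset.sum_pos (fun j _ => div_pos (mul_pos two_pos (weight_pos (ha j)))
      (Complex.normSq_pos.2 (sub_ne_zero.2 (hzu j)))) Finset.univ_nonempty
  have : -∑ j, 2 * weight a j / Complex.normSq (z - u j) = 0 := by exact_mod_cast hsum.symm
  linarith

/-- The interlacing equation has exactly `n` solutions, all of them on the unit circle. -/
theorem exists_circlePoints_isInterlacingSolution
    (hn : 0 < n) (ha : ∀ j, (a : EuclideanSpace ℂ (Fin n)) j ≠ 0) (hu : Function.Injective u)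
    (h : ℝ) : ∃ S : CirclePoints n, (fun x : Circle => (x : ℂ)) '' (S.carrier : Set Circle) =
      {z : ℂ | IsInterlacingSolution u (weight a) h z} := by
  classical
  set Q := interlacingPoly u (weight a) h with hQ
  have hQd : Q.natDegree = n := natDegree_interlacingPoly hn _ _
  have hQ0 : Q ≠ 0 := by
    intro h0
    rw [h0, natDegree_zero] at hQd
    omega
  have hnodup : Q.roots.Nodup := by
    rw [Multiset.nodup_iff_count_le_one]
    intro z
    rw [count_roots]
    by_contra hlt
    push Not at hlt
    obtain ⟨h1, h2⟩ := (one_lt_rootMultiplicity_iff_isRoot hQ0).1 hlt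
    exact eval_derivative_interlacingPoly_ne_zero hn ha hu h1 h2
  have hcard : Q.roots.toFinset.card = n := by
    rw [Multiset.toFinset_card_of_nodup hnodup, ← hQd]
    exact (splits_iff_card_roots.1 (IsAlgClosed.splits Q))
  have hmem (z : ℂ) : z ∈ Q.roots.toFinset ↔ IsInterlacingSolution u (weight a) h z := by
    rw [isInterlacingSolution_iff ha hu, Multiset.mem_toFinset, mem_roots hQ0, IsRoot.def]
  have hnorm (z : ℂ) (hz : z ∈ Q.roots.toFinset) : z ∈ Submonoid.unitSphere ℂ := by
    change _ ∈ Metric.sphere (0 : ℂ) 1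
    rw [mem_sphere_zero_iff_norm]
    exact norm_eq_one_of_isInterlacingSolution hn ha ((hmem z).1 hz)
  let e : Q.roots.toFinset → Circle := fun z => ⟨z, hnorm z z.2⟩
  have he : Function.Injective e := fun x y hxy => Subtype.ext (congrArg (fun c : Circle => (c : ℂ)) hxy)
  refine ⟨⟨Finset.univ.image e, ?_⟩, ?_⟩
  · rw [Finset.card_image_of_injective _ he, Finset.card_univ, Fintype.card_coe, hcard]
  · ext z
    simp only [Finset.coe_image, Finset.coe_univ, Set.image_univ, Set.mem_image,
      Set.mem_range, Set.mem_ofPred_eq, ← hmem]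
    constructor
    · rintro ⟨_, ⟨x, rfl⟩, rfl⟩
      exact x.2
    · intro hz
      exact ⟨_, ⟨⟨z, hz⟩, rfl⟩, rfl⟩

end Spectral

/-! ### Measurability of the orthogonal polynomials -/

theorem Circle.measurable_coe : Measurable (fun x : Circle => (x : ℂ)) :=
  Continuous.measurable (by fun_prop)

theorem measurable_weight {n : ℕ} (j : Fin n) :
    Measurable fun a : ComplexSphere n => weight a j := by
  unfold weight
  fun_prop

/-- The evaluation point must be allowed to vary with `ω`: the Gram-Schmidt coefficients involve
values of earlier polynomials at the random nodes. -/
theorem measurable_eval_monicOrthogonal {Ω : Type*} [MeasurableSpace Ω] {n : ℕ}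
    {u : Ω → Fin n → Circle} (hu : Measurable u) {a : Ω → ComplexSphere n} (ha : Measurable a)
    (k : ℕ) {z : Ω → ℂ} (hz : Measurable z) :
    Measurable fun ω => (monicOrthogonal (spectralMeasure (u ω) (a ω)) k).eval (z ω) := by
  induction k using Nat.strong_induction_on generalizing z with
  | _ k ih =>
    have hj (j : Fin n) : Measurable fun ω => (u ω j : ℂ) :=
      Circle.measurable_coe.comp ((measurable_pi_apply j).comp hu)
    have hw (j : Fin n) : Measurable fun ω => (weight (a ω) j : ℂ) :=
      Complex.measurable_ofReal.comp ((measurable_weight j).comp ha)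
    have hconj : Measurable (starRingEnd ℂ) := Complex.continuous_conj.measurable
    have heq (ω : Ω) : (monicOrthogonal (spectralMeasure (u ω) (a ω)) k).eval (z ω) =
        z ω ^ k - ∑ i : Fin k,
          polyInner (spectralMeasure (u ω) (a ω))
              (monicOrthogonal (spectralMeasure (u ω) (a ω)) i) (X ^ k) /
            polyInner (spectralMeasure (u ω) (a ω))
              (monicOrthogonal (spectralMeasure (u ω) (a ω)) i)
              (monicOrthogonal (spectralMeasure (u ω) (a ω)) i) *
            (monicOrthogonal (spectralMeasure (u ω) (a ω)) i).eval (z ω) := by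
      rw [monicOrthogonal]
      simp only [eval_sub, eval_pow, eval_X, eval_finsetSum, eval_mul, eval_C]
    simp only [heq, polyInner_spectralMeasure, eval_pow, eval_X]
    refine (hz.pow_const k).sub (Finset.measurable_fun_sum _ fun i _ => ?_)
    have hi (j : Fin n) := ih i i.2 (hj j)
    refine (Measurable.div ?_ ?_).mul (ih i i.2 hz)
    · exact Finset.measurable_fun_sum _ fun j _ =>
        (hw j).mul ((hconj.comp (hi j)).mul ((hj j).pow_const k))
    · exact Finset.measurable_fun_sum _ fun j _ => (hw j).mul ((hconj.comp (hi j)).mul (hi j))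

/-- The vector of the Verblunsky coefficients `α_0, …, α_{n-1}`. -/
noncomputable def verblunskyVec {n : ℕ} (u : Fin n → Circle) (a : ComplexSphere n) :
    Fin n → ℂ :=
  fun k => verblunsky (spectralMeasure u a) k

theorem measurable_verblunskyVec {Ω : Type*} [MeasurableSpace Ω] {n : ℕ}
    {u : Ω → Fin n → Circle} (hu : Measurable u) {a : Ω → ComplexSphere n}
    (ha : Measurable a) : Measurable fun ω => verblunskyVec (u ω) (a ω) := by
  refine measurable_pi_lambda _ fun k => ?_
  exact (Complex.continuous_conj.measurable.comp
    (measurable_eval_monicOrthogonal hu ha _ measurable_const)).neg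

/-- A finite vector of coefficients, completed by zeros. -/
noncomputable def extendZero {n : ℕ} (α : Fin n → ℂ) (k : ℕ) : ℂ :=
  if h : k < n then α ⟨k, h⟩ else 0

theorem measurable_extendZero {n : ℕ} (k : ℕ) :
    Measurable fun α : Fin n → ℂ => extendZero α k := by
  unfold extendZero
  split_ifs with h
  · exact measurable_pi_apply _
  · exact measurable_const

theorem measurable_szegoVec {n : ℕ} (z : ℂ) (v : ℂ × ℂ) (k : ℕ) :
    Measurable fun α : Fin n → ℂ => szegoVec (extendZero α) z v k := by
  induction k with
  | zero => exact measurable_const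
  | succ k ih =>
    have hconj : Measurable (starRingEnd ℂ) := Complex.continuous_conj.measurable
    have hα := measurable_extendZero (n := n) k
    exact ((ih.fst.const_mul z).sub ((hconj.comp hα).mul ih.snd)).prodMk
      (ih.snd.sub (hα.mul (ih.fst.const_mul z)))

/-! ### Measurability of the zero set -/

theorem CirclePoints.measurable_iff {Ω : Type*} [MeasurableSpace Ω] {n : ℕ}
    {f : Ω → CirclePoints n} :
    Measurable f ↔ ∀ B : Set Circle, MeasurableSet B →
      Measurable fun ω => (((f ω).carrier : Set Circle) ∩ B).ncard := by
  simp only [measurable_iff_comap_le, CirclePoints.measurableSpace, MeasurableSpace.comap_iSup,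
    iSup_le_iff, MeasurableSpace.comap_comp]
  rfl

/-- The tuples of points of the circle, numbered by increasing arguments. -/
def SortedTuple (n : ℕ) : Type :=
  {v : Fin n → Circle // StrictMono fun i => Complex.arg (v i)}

noncomputable instance (n : ℕ) : MeasurableSpace (SortedTuple n) := Subtype.instMeasurableSpace

/-- This makes the Lusin-Souslin theorem available for injective measurable maps out of this space.
-/
instance (n : ℕ) : StandardBorelSpace (SortedTuple n) := by
  refine MeasurableSet.standardBorel
    (s := {v : Fin n → Circle | StrictMono fun i => Complex.arg (v i)}) ?_
  have h : {v : Fin n → Circle | StrictMono fun i => Complex.arg (v i)} =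
      ⋂ i, ⋂ j, ⋂ (_ : i < j), {v : Fin n → Circle | Complex.arg (v i) < Complex.arg (v j)} := by
    ext v
    simp [StrictMono]
  rw [h]
  have hm (i : Fin n) : Measurable fun v : Fin n → Circle => Complex.arg (v i) :=
    Complex.measurable_arg.comp (Circle.measurable_coe.comp (measurable_pi_apply i))
  exact MeasurableSet.iInter fun i => MeasurableSet.iInter fun j => MeasurableSet.iInter fun _ =>
    measurableSet_lt (hm i) (hm j)

namespace SortedTuple

variable {n : ℕ}

theorem measurable_apply (i : Fin n) : Measurable fun v : SortedTuple n => v.1 i :=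
  (measurable_pi_apply i).comp measurable_subtype_coe

theorem injective (v : SortedTuple n) : Function.Injective v.1 := fun _ _ h =>
  v.2.injective (congrArg (fun z : Circle => Complex.arg z) h)

theorem eq_of_range_eq {v w : SortedTuple n} (h : Set.range v.1 = Set.range w.1) : v = w := by
  have harg : (fun i => Complex.arg (v.1 i)) = fun i => Complex.arg (w.1 i) := by
    refine (StrictMono.range_inj v.2 w.2).1 ?_
    have := congrArg (fun s => (fun z : Circle => Complex.arg z) '' s) h
    rwa [← Set.range_comp, ← Set.range_comp] at this
  exact Subtype.ext (funext fun i => Circle.injective_arg (congrFun harg i))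

/-- The set of the points of a tuple. -/
def toPoints (v : SortedTuple n) : CirclePoints n where
  carrier := Finset.univ.map ⟨v.1, v.injective⟩
  card_eq := by simp

theorem measurable_toPoints : Measurable (toPoints : SortedTuple n → CirclePoints n) := by
  classical
  refine CirclePoints.measurable_iff.2 fun B hB => ?_
  have h (v : SortedTuple n) : ((v.toPoints.carrier : Set Circle) ∩ B).ncard =
      ∑ i, if v.1 i ∈ B then 1 else 0 := by
    have : (v.toPoints.carrier : Set Circle) ∩ B =
        ((Finset.univ.filter fun i => v.1 i ∈ B).map ⟨v.1, v.injective⟩ : Finset Circle) := by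
      ext x
      simp only [toPoints, Finset.coe_map, Function.Embedding.coeFn_mk, Finset.coe_univ,
        Set.image_univ, Set.mem_inter_iff, Set.mem_range, Set.mem_image, Finset.mem_coe,
        Finset.mem_filter, Finset.mem_univ, true_and]
      constructor
      · rintro ⟨⟨i, rfl⟩, hi⟩
        exact ⟨i, hi, rfl⟩
      · rintro ⟨i, hi, rfl⟩
        exact ⟨⟨i, rfl⟩, hi⟩
    rw [this, Set.ncard_coe_finset, Finset.card_map, Finset.card_filter]
  simp only [h]
  exact Finset.measurable_fun_sum _ fun i _ =>
    Measurable.ite (measurable_apply i hB) measurable_const measurable_const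

theorem exists_toPoints_eq (V : CirclePoints n) : ∃ v : SortedTuple n, v.toPoints = V := by
  set s : Finset ℝ := V.carrier.map ⟨_, Circle.injective_arg⟩
  have hs : s.card = n := by rw [Finset.card_map, V.card_eq]
  have hmem (i : Fin n) : ∃ z ∈ V.carrier, Complex.arg z = s.orderEmbOfFin hs i :=
    Finset.mem_map.1 (s.orderEmbOfFin_mem hs i)
  choose v hv hvs using hmem
  refine ⟨⟨v, ?_⟩, ?_⟩
  · simp only [hvs]
    exact (s.orderEmbOfFin hs).strictMono
  · refine CirclePoints.ext (Finset.eq_of_subset_of_card_le (fun x hx => ?_) ?_)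
    · obtain ⟨i, -, rfl⟩ := Finset.mem_map.1 hx
      exact hv i
    · rw [V.card_eq, CirclePoints.card_eq]

/-- The values at the natural numbers of the monic polynomial vanishing on the tuple. -/
noncomputable def nodalValues (v : SortedTuple n) (m : ℕ) : ℂ :=
  (∏ j, (X - C (v.1 j : ℂ))).eval (m : ℂ)

theorem measurable_nodalValues :
    Measurable (nodalValues : SortedTuple n → ℕ → ℂ) := by
  refine measurable_pi_lambda _ fun m => ?_
  simp only [nodalValues, eval_prod, eval_sub, eval_X, eval_C]
  exact Finset.measurable_fun_prod _ fun j _ =>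
    (Circle.measurable_coe.comp (measurable_apply j)).const_sub _

theorem range_subset_of_prod_eq {v w : SortedTuple n}
    (h : ∏ j, (X - C (v.1 j : ℂ)) = ∏ j, (X - C (w.1 j : ℂ))) :
    Set.range v.1 ⊆ Set.range w.1 := by
  rintro _ ⟨i, rfl⟩
  have := congrArg (eval (v.1 i : ℂ)) h
  rw [eval_prod, Finset.prod_eq_zero (Finset.mem_univ i) (by simp), eval_prod] at this
  obtain ⟨j, -, hj⟩ := Finset.prod_eq_zero_iff.1 this.symm
  rw [eval_sub, eval_X, eval_C] at hj
  exact ⟨j, (Circle.ext (sub_eq_zero.1 hj)).symm⟩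

/-- Values at infinitely many points determine the nodal polynomial, its roots determine the set,
and the ordering by argument determines the tuple. -/
theorem injective_nodalValues :
    Function.Injective (nodalValues : SortedTuple n → ℕ → ℂ) := by
  intro v w h
  have hp : ∏ j, (X - C (v.1 j : ℂ)) = ∏ j, (X - C (w.1 j : ℂ)) := by
    refine eq_of_infinite_eval_eq _ _
      ((Set.infinite_range_of_injective (Nat.cast_injective (R := ℂ))).mono ?_)
    rintro _ ⟨m, rfl⟩
    exact congrFun h m
  exact eq_of_range_eq ((range_subset_of_prod_eq hp).antisymm (range_subset_of_prod_eq hp.symm))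

end SortedTuple

/-- The zero set of `Φ_n` is a measurable function of the coefficients. -/
theorem exists_measurable_zeroSet {n : ℕ} [Nonempty (CirclePoints n)] :
    ∃ S : (Fin n → ℂ) → CirclePoints n, Measurable S ∧ ∀ α (V : CirclePoints n),
      (∀ x ∈ V.carrier, (szegoPoly (extendZero α) n).1.eval (x : ℂ) = 0) → S α = V := by
  have hne : Nonempty (SortedTuple n) :=
    ⟨(SortedTuple.exists_toPoints_eq (Classical.arbitrary (CirclePoints n))).choose⟩
  -- By Lusin-Souslin, `nodalValues` is a measurable embedding, so its inverse on the range extends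
  -- to a measurable `g` on all sequences.
  obtain ⟨g, hg, hgid⟩ := (SortedTuple.measurable_nodalValues (n := n)).measurableEmbedding
    SortedTuple.injective_nodalValues |>.exists_measurable_extend measurable_id fun _ => hne
  refine ⟨fun α => (g fun m => (szegoVec (extendZero α) m (1, 1) n).1).toPoints,
    SortedTuple.measurable_toPoints.comp (hg.comp
      (measurable_pi_lambda _ fun m => (measurable_szegoVec _ _ _).fst)), fun α V hV => ?_⟩
  obtain ⟨v, rfl⟩ := SortedTuple.exists_toPoints_eq V
  have hp : (szegoPoly (extendZero α) n).1 = ∏ j, (X - C (v.1 j : ℂ)) :=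
    (monic_szegoPoly _ _).eq_prod_of_eval_circle (natDegree_szegoPoly _ _) v.injective fun j =>
      hV _ (Finset.mem_map.2 ⟨j, Finset.mem_univ j, rfl⟩)
  have hval : (fun m : ℕ => (szegoVec (extendZero α) m (1, 1) n).1) = v.nodalValues := by
    funext m
    rw [← eval_szegoPoly, SortedTuple.nodalValues, hp]
  exact congrArg SortedTuple.toPoints (by rw [hval]; exact congrFun hgid v)

/-! ### Law of the solution set and stationarity. -/

theorem measurable_cayleyCircle : Measurable fun h : ℝ => (cayleyCircle h : ℂ) := by
  simp only [coe_cayleyCircle]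
  fun_prop

/-- Only the first `n` coefficients enter the `n`-th polynomial, so the padding by zeros is
harmless. -/
theorem eval_szegoPoly_extendZero {n : ℕ} (α : ℕ → ℂ) (z : ℂ) :
    (szegoPoly (extendZero fun k : Fin n => α k) n).1.eval z = (szegoPoly α n).1.eval z := by
  have h := szegoVec_congr (α := extendZero fun k : Fin n => α k) (β := α) z (1, 1) (n := n)
    fun k hk => by simp [extendZero, hk]
  rw [← eval_szegoPoly, ← eval_szegoPoly] at h
  exact (Prod.mk.inj h).1

theorem CirclePoints.injective_of_range_eq {n : ℕ} {V : CirclePoints n} {u : Fin n → Circle}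
    (h : Set.range u = (V.carrier : Set Circle)) : Function.Injective u := by
  classical
  have h1 : Finset.univ.image u = V.carrier := by
    rw [← Finset.coe_inj, Finset.coe_image, Finset.coe_univ, Set.image_univ, h]
  have h2 : Set.InjOn u (Finset.univ : Finset (Fin n)) := Finset.card_image_iff.1 (by
    rw [h1, V.card_eq, Finset.card_univ, Fintype.card_fin])
  rwa [Finset.coe_univ, Set.injOn_univ] at h2

/-- If for every fixed `y` the image of `μ` under `f · y` is `ξ`, then so is the image of
`μ ⊗ ν` under `f`. -/
theorem MeasureTheory.Measure.map_prod_eq_of_forall_map_eq {X Y Z : Type*} [MeasurableSpace X]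
    [MeasurableSpace Y] [MeasurableSpace Z] {μ : Measure X} [SFinite μ] {ν : Measure Y}
    [IsProbabilityMeasure ν] {ξ : Measure Z} {f : X × Y → Z} (hf : Measurable f)
    (h : ∀ y, μ.map (fun x => f (x, y)) = ξ) : (μ.prod ν).map f = ξ := by
  ext s hs
  rw [Measure.map_apply hf hs, Measure.prod_apply_symm (hf hs)]
  have (y : Y) : μ ((fun x => (x, y)) ⁻¹' (f ⁻¹' s)) = ξ s := by
    rw [← h y]
    exact (Measure.map_apply (hf.comp measurable_prodMk_right) hs).symm
  simp [this]

theorem mainTheorem5 (n : ℕ)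
    -- the law of `(a, h)`
    (π : Measure (ComplexSphere n × ℝ)) [IsProbabilityMeasure π]
    (hindep : IndepFun (fun p : ComplexSphere n × ℝ => p.1) (fun p => p.2) π)
    (hperm : ∀ s : Equiv.Perm (Fin n),
      π.map (fun p (j : Fin n) => (p.1 : EuclideanSpace ℂ (Fin n)) (s j)) =
        π.map (fun p (j : Fin n) => (p.1 : EuclideanSpace ℂ (Fin n)) j))
    (hphase : ∀ c : Fin n → Circle,
      π.map (fun p (j : Fin n) => (c j : ℂ) * (p.1 : EuclideanSpace ℂ (Fin n)) j) =
        π.map (fun p (j : Fin n) => (p.1 : EuclideanSpace ℂ (Fin n)) j))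
    (hne : ∀ᵐ p ∂π, ∀ j : Fin n, (p.1 : EuclideanSpace ℂ (Fin n)) j ≠ 0)
    -- the law of the set of `n` points
    (P : Measure (CirclePoints n)) [IsProbabilityMeasure P]
    -- an arbitrary measurable enumeration `V = {u_1, …, u_n}` of the points of `V`
    (u : CirclePoints n → Fin n → Circle) (hu : Measurable u)
    (hrange : ∀ V, Set.range (u V) = (V.carrier : Set Circle))
    -- the law of the Verblunsky coefficients is invariant by rotation
    (hrot : ∀ c : Circle,
      (P.prod π).map (fun ω (k : Fin n) =>
          (c : ℂ) * verblunsky (spectralMeasure (u ω.1) ω.2.1) k) =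
        (P.prod π).map (fun ω (k : Fin n) =>
          verblunsky (spectralMeasure (u ω.1) ω.2.1) k)) :
    -- `W` is the (random) set of solutions
    ∃ W : CirclePoints n × (ComplexSphere n × ℝ) → CirclePoints n,
      Measurable W ∧
      (∀ V, ∀ᵐ p ∂π, (fun x : Circle => (x : ℂ)) '' ((W (V, p)).carrier : Set Circle) =
        {z : ℂ | IsInterlacingSolution (u V) (weight p.1) p.2 z}) ∧
      -- its law is `P`
      (P.prod π).map W = P ∧
      -- `P` is invariant for the Markov chain with transition `V ↦ law of W (V, ·) under π`
      Kernel.Invariant ((Kernel.id ×ₖ Kernel.const (CirclePoints n) π).map W) P := by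
  have hn : 0 < n := by
    obtain ⟨p⟩ := π.nonempty_of_neZero
    rcases Nat.eq_zero_or_pos n with rfl | h
    · simpa using sum_weight p.1
    · exact h
  have hVne : Nonempty (CirclePoints n) := P.nonempty_of_neZero
  obtain ⟨S, hS, hSV⟩ := exists_measurable_zeroSet (n := n)
  have hinj (V : CirclePoints n) : Function.Injective (u V) :=
    CirclePoints.injective_of_range_eq (hrange V)
  set α : CirclePoints n × ComplexSphere n → Fin n → ℂ := fun x => verblunskyVec (u x.1) x.2
  have hαm : Measurable α :=
    measurable_verblunskyVec (hu.comp measurable_fst) measurable_snd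
  -- `W` is defined everywhere from the rotated coefficients, which gives its measurability; it is
  -- identified with the solution set only where all `a_j` are nonzero.
  set f : (CirclePoints n × ComplexSphere n) × ℝ → CirclePoints n :=
    fun y => S fun k => (cayleyCircle y.2 : ℂ) * α y.1 k with hf
  have hfm : Measurable f := hS.comp (measurable_pi_lambda _ fun k =>
    (measurable_cayleyCircle.comp measurable_snd).mul
      ((measurable_pi_apply k).comp (hαm.comp measurable_fst)))
  set W : CirclePoints n × (ComplexSphere n × ℝ) → CirclePoints n :=
    fun ω => f (MeasurableEquiv.prodAssoc.symm ω) with hW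
  have hWm : Measurable W := hfm.comp MeasurableEquiv.prodAssoc.symm.measurable
  have hlaw : (P.prod π).map W = P := by
    have hπ : π = (π.map Prod.fst).prod (π.map Prod.snd) := by
      have h := (indepFun_iff_map_prod_eq_prod_map_map measurable_fst.aemeasurable
        measurable_snd.aemeasurable).1 hindep
      rw [← h]
      exact Measure.map_id.symm
    have : IsProbabilityMeasure (π.map Prod.fst) :=
      Measure.isProbabilityMeasure_map measurable_fst.aemeasurable
    have : IsProbabilityMeasure (π.map Prod.snd) :=
      Measure.isProbabilityMeasure_map measurable_snd.aemeasurable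
    have hfst : P.prod (π.map Prod.fst) = (P.prod π).map (Prod.map id Prod.fst) := by
      rw [← Measure.map_prod_map P π measurable_id measurable_fst, Measure.map_id]
    -- The unrotated coefficients almost surely give back `V`, whose law is `P`.
    have hbase : (P.prod (π.map Prod.fst)).map (S ∘ α) = P := by
      have hae : (fun ω : CirclePoints n × (ComplexSphere n × ℝ) =>
          S (α (Prod.map id Prod.fst ω))) =ᵐ[P.prod π] Prod.fst := by
        filter_upwards [Measure.quasiMeasurePreserving_snd.ae hne] with ω hω
        refine hSV _ _ fun x hx => ?_
        rw [← Finset.mem_coe, ← hrange] at hx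
        obtain ⟨j, rfl⟩ := hx
        refine (eval_szegoPoly_extendZero _ _).trans ?_
        refine (congrArg (eval _) (szegoPoly_verblunsky hω (hinj ω.1) le_rfl)).trans ?_
        exact monicOrthogonal_eval_node hω (hinj _) j
      rw [hfst, Measure.map_map (hS.comp hαm) (by fun_prop)]
      refine (Measure.map_congr hae).trans ?_
      rw [Measure.map_fst_prod, measure_univ, one_smul]
    -- For fixed `h` the rotation is by a constant, so `hrot` applies; independence then allows
    -- integration over `h`.
    have hrotate (h : ℝ) : (P.prod (π.map Prod.fst)).map (fun x => f (x, h)) = P := by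
      have hm : Measurable fun x k => (cayleyCircle h : ℂ) * α x k :=
        measurable_pi_lambda _ fun k => ((measurable_pi_apply k).comp hαm).const_mul _
      have h1 : (P.prod (π.map Prod.fst)).map (fun x k => (cayleyCircle h : ℂ) * α x k) =
          (P.prod (π.map Prod.fst)).map α := by
        rw [hfst, Measure.map_map hm (by fun_prop), Measure.map_map hαm (by fun_prop)]
        exact hrot (cayleyCircle h)
      have h2 := Measure.map_map (μ := P.prod (π.map Prod.fst)) hS hm
      rw [h1, Measure.map_map hS hαm] at h2
      exact h2.symm.trans hbase
    have h3 := Measure.map_prod_eq_of_forall_map_eq (ν := π.map Prod.snd) hfm hrotate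
    conv_lhs => rw [hπ]
    rw [← Measure.prodAssoc_prod, Measure.map_map hWm MeasurableEquiv.prodAssoc.measurable]
    exact h3
  refine ⟨W, hWm, fun V => ?_, hlaw, ?_⟩
  · filter_upwards [hne] with p hp
    obtain ⟨T, hT⟩ := exists_circlePoints_isInterlacingSolution hn hp (hinj V) p.2
    rw [← hT]
    have : W (V, p) = T := by
      refine hSV _ _ fun x hx => ?_
      have hx' : IsInterlacingSolution (u V) (weight p.1) p.2 (x : ℂ) :=
        hT.subset ⟨x, hx, rfl⟩
      exact (eval_szegoPoly_extendZero _ _).trans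
        (eval_szegoPoly_of_isInterlacingSolution hp (hinj V) hx')
    rw [this]
  -- One step of the chain from `P` is the image of `P ⊗ π` under `W`.
  · rw [Kernel.Invariant, ← Measure.map_comp _ _ hWm, ← Measure.compProd_eq_comp_prod,
      Measure.compProd_const, hlaw]
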